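/- Let $\boldsymbol{\nu}:\mathbb{N}=\{1,2,\dots\}\to\mathbb{C}$ be a multiplicative function (that is, $\boldsymbol{\nu}(1)=1$ and $\boldsymbol{\nu}(mn)=\boldsymbol{\nu}(m)\boldsymbol{\nu}(n)$ whenever $m,n$ are coprime) with $|\boldsymbol{\nu}(n)|\le 1$ for all $n$. Then, for each nonconstant polynomial $P\in\mathbb{R}[x]$ with irrational leading coefficient, \[ \frac1M\sum_{M\le m<2M}\frac1H\left|\sum_{m\le n<m+H}e^{2\pi iP(n)}\boldsymbol{\nu}(n)\right|\longrightarrow 0 \] as the positive integers $M,H$ satisfy $M\to\infty$, $H\to\infty$, $H/M\to0$; that is, for every $\varepsilon>0$ there are $N\in\mathbb{N}$ and $\delta>0$ such that the left-hand side is less than $\varepsilon$ for all integers $M\ge N$, $H\ge N$ with $H/M<\delta$. -/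

import Mathlib

open Filter Topology

/-! Windows starting in a fixed residue class `r` modulo `H` tile an interval. Multiplying each
window sum by a conjugate sign `b j` of modulus at most 1 removes the absolute values
(`exists_block_weight`). What remains is one long sum of `a n * ν n` with `a n = b ((n - r) / H) *
phase (P n)`, of length `N` comparable to `M`.

By `katai_criterion`, such a sum is `O(N / √A)`, where `A = ∑ 1/p` over a finite set `S` of primes,
provided that `a (p m)` and `a (q m)` are nearly uncorrelated for distinct `p, q ∈ S`. Since `∑ 1/p`
diverges, `A` can be taken as large as desired.

The correlation is a sum of `phase (P(pm) - P(qm))` against a weight with at most about `(p + q) N /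
H` jumps. The leading coefficient of this difference is `p^d - q^d` times that of `P`, hence
irrational. `weyl_sum_le` bounds each constant piece of length `L` by `η L + C`, where `C` does not
see the lower-order coefficients and so serves all pieces. The total `η N + C ((p + q) N / H + 1)`
is small once `H` and `N` are large (`exists_correlation_bound`). -/

/-- The additive character `x ↦ e^{2πix}` of the reals. -/
noncomputable def phase (x : ℝ) : ℂ :=
  Complex.exp (2 * (Real.pi : ℂ) * Complex.I * (x : ℂ))

lemma norm_phase (x : ℝ) : ‖phase x‖ = 1 := by
  have h : (2 * (Real.pi : ℂ) * Complex.I * (x : ℂ)) = ((2 * Real.pi * x : ℝ) : ℂ) * Complex.I := by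
    push_cast; ring
  rw [phase, h, Complex.norm_exp_ofReal_mul_I]

lemma phase_add (x y : ℝ) : phase (x + y) = phase x * phase y := by
  rw [phase, phase, phase, ← Complex.exp_add]
  push_cast
  ring_nf

lemma conj_phase (x : ℝ) : (starRingEnd ℂ) (phase x) = phase (-x) := by
  rw [phase, phase, ← Complex.exp_conj]
  simp [Complex.conj_ofNat]

lemma phase_mul_conj (x y : ℝ) : phase x * (starRingEnd ℂ) (phase y) = phase (x - y) := by
  rw [conj_phase, ← phase_add, sub_eq_add_neg]

lemma phase_ne_one {x : ℝ} (hx : Irrational x) : phase x ≠ 1 := by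
  intro h
  obtain ⟨n, hn⟩ := Complex.exp_eq_one_iff.1 h
  have hne : (2 * (Real.pi : ℂ) * Complex.I) ≠ 0 := Complex.two_pi_I_ne_zero
  have h1 : (x : ℂ) = n := mul_left_cancel₀ hne (hn.trans (mul_comm _ _))
  exact hx.ne_int n (by exact_mod_cast h1)

/-! ### Van der Corput's inequality and uniform Weyl bounds -/

/-- Cauchy–Schwarz followed by expansion of the square. -/
lemma sq_sum_norm_sum_le {ι κ : Type*} (s : Finset ι) (t : Finset κ) (g : κ → ι → ℂ) :
    (∑ n ∈ s, ‖∑ k ∈ t, g k n‖) ^ 2 ≤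
      s.card * ∑ k ∈ t, ∑ l ∈ t, ‖∑ n ∈ s, g k n * (starRingEnd ℂ) (g l n)‖ := by
  refine sq_sum_le_card_mul_sum_sq.trans ?_
  gcongr
  have key : ((∑ n ∈ s, ‖∑ k ∈ t, g k n‖ ^ 2 : ℝ) : ℂ) =
      ∑ k ∈ t, ∑ l ∈ t, ∑ n ∈ s, g k n * (starRingEnd ℂ) (g l n) := by
    calc ((∑ n ∈ s, ‖∑ k ∈ t, g k n‖ ^ 2 : ℝ) : ℂ)
        = ∑ n ∈ s, ∑ k ∈ t, ∑ l ∈ t, g k n * (starRingEnd ℂ) (g l n) := by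
          push_cast
          refine Finset.sum_congr rfl fun n _ => ?_
          rw [← Complex.mul_conj', map_sum, Finset.sum_mul_sum]
      _ = _ := by
          rw [Finset.sum_comm]
          refine Finset.sum_congr rfl fun k _ => ?_
          rw [Finset.sum_comm]
  have h0 : 0 ≤ ∑ n ∈ s, ‖∑ k ∈ t, g k n‖ ^ 2 := by positivity
  calc ∑ n ∈ s, ‖∑ k ∈ t, g k n‖ ^ 2
      = ‖((∑ n ∈ s, ‖∑ k ∈ t, g k n‖ ^ 2 : ℝ) : ℂ)‖ := by
        rw [Complex.norm_real, Real.norm_of_nonneg h0]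
    _ ≤ _ := by
        rw [key]
        exact (norm_sum_le _ _).trans (Finset.sum_le_sum fun k _ => norm_sum_le _ _)

/-- Both sums lie inside the sum over `range (L + k)`; they differ by `k` terms at either end. -/
lemma norm_sum_range_sub_shift_le (u : ℕ → ℂ) (hu : ∀ n, ‖u n‖ ≤ 1) (L k : ℕ) :
    ‖∑ n ∈ Finset.range L, u n - ∑ n ∈ Finset.range L, u (n + k)‖ ≤ 2 * k := by
  have h1 : ∑ n ∈ Finset.range L, u n + ∑ n ∈ Finset.range k, u (L + n) =
      ∑ n ∈ Finset.range k, u n + ∑ n ∈ Finset.range L, u (n + k) := by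
    rw [← Finset.sum_range_add, add_comm L k, Finset.sum_range_add]
    simp only [add_comm]
  have h2 : ∑ n ∈ Finset.range L, u n - ∑ n ∈ Finset.range L, u (n + k) =
      ∑ n ∈ Finset.range k, u n - ∑ n ∈ Finset.range k, u (L + n) := by
    linear_combination h1
  have hb : ∀ v : ℕ → ℂ, (∀ n, ‖v n‖ ≤ 1) → ‖∑ n ∈ Finset.range k, v n‖ ≤ k := fun v hv => by
    simpa using norm_sum_le_of_le (Finset.range k) (fun n _ => hv n)
  rw [h2]
  refine (norm_sub_le _ _).trans ?_
  linarith [hb u hu, hb (fun n => u (L + n)) fun n => hu _]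

/-- Van der Corput's inequality. -/
lemma van_der_corput (u : ℕ → ℂ) (hu : ∀ n, ‖u n‖ ≤ 1) (L K : ℕ) :
    ∃ T : ℝ, 0 ≤ T ∧ K * ‖∑ n ∈ Finset.range L, u n‖ ≤ 2 * K ^ 2 + T ∧
      T ^ 2 ≤ L * ∑ k ∈ Finset.range K, ∑ l ∈ Finset.range K,
        ‖∑ n ∈ Finset.range L, u (n + k) * (starRingEnd ℂ) (u (n + l))‖ := by
  -- Averaging over `K` shifts costs at most `2 * K` per shift, whence `2 * K ^ 2`; Cauchy–Schwarz
  -- then bounds the square of the averaged sum `T`.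
  refine ⟨∑ n ∈ Finset.range L, ‖∑ k ∈ Finset.range K, u (n + k)‖, by positivity, ?_, ?_⟩
  · have h1 : (K : ℂ) * ∑ n ∈ Finset.range L, u n =
        ∑ k ∈ Finset.range K, (∑ n ∈ Finset.range L, u n - ∑ n ∈ Finset.range L, u (n + k)) +
          ∑ n ∈ Finset.range L, ∑ k ∈ Finset.range K, u (n + k) := by
      rw [Finset.sum_comm (s := Finset.range L), ← Finset.sum_add_distrib]
      simp
    have h2 : (K : ℝ) * ‖∑ n ∈ Finset.range L, u n‖ = ‖(K : ℂ) * ∑ n ∈ Finset.range L, u n‖ := by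
      simp
    rw [h2, h1]
    refine (norm_add_le _ _).trans (add_le_add ?_ (norm_sum_le _ _))
    refine (norm_sum_le_of_le (f := _) (n := fun _ => 2 * (K : ℝ)) _ fun k hk => ?_).trans ?_
    · refine (norm_sum_range_sub_shift_le u hu L k).trans ?_
      have : (k : ℝ) ≤ K := by exact_mod_cast (Finset.mem_range.1 hk).le
      linarith
    · simp; nlinarith
  · simpa using sq_sum_norm_sum_le (Finset.range L) (Finset.range K) (fun k n => u (n + k))

lemma fwdDiff_iter_sub (f g : ℕ → ℝ) (n x : ℕ) :
    (fwdDiff 1)^[n] (fun x => f x - g x) x = (fwdDiff 1)^[n] f x - (fwdDiff 1)^[n] g x := by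
  simp only [fwdDiff_iter_eq_sum_shift, ← Finset.sum_sub_distrib, smul_sub]

lemma eq_add_mul_of_fwdDiff_const {f : ℕ → ℝ} {c : ℝ} (hf : ∀ n, fwdDiff 1 f n = c) (n : ℕ) :
    f n = f 0 + n * c := by
  induction n with
  | zero => simp
  | succ n ih =>
    have := hf n
    simp only [fwdDiff] at this
    push_cast
    linarith

/-- Weyl's theorem with a bound depending only on the top-order difference. -/
theorem weyl_sum_le (d : ℕ) : ∀ c : ℝ, Irrational c → ∀ ε : ℝ, 0 < ε → ∃ C : ℝ, 0 ≤ C ∧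
    ∀ f : ℕ → ℝ, (∀ n, (fwdDiff 1)^[d + 1] f n = c) → ∀ L : ℕ,
      ‖∑ n ∈ Finset.range L, phase (f n)‖ ≤ ε * L + C := by
  induction d with
  | zero =>
    intro c hc ε hε
    have hne : phase c - 1 ≠ 0 := sub_ne_zero.2 (phase_ne_one hc)
    refine ⟨2 / ‖phase c - 1‖, by positivity, fun f hf L => ?_⟩
    have hpow : ∀ n : ℕ, phase (n * c) = phase c ^ n := fun n => by
      rw [phase, phase, ← Complex.exp_nat_mul]; push_cast; ring_nf
    have hsum : ∑ n ∈ Finset.range L, phase (f n) =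
        phase (f 0) * ((phase c ^ L - 1) / (phase c - 1)) := by
      rw [← geom_sum_eq (phase_ne_one hc), Finset.mul_sum]
      refine Finset.sum_congr rfl fun n _ => ?_
      rw [eq_add_mul_of_fwdDiff_const hf n, phase_add, hpow]
    rw [hsum, norm_mul, norm_phase, one_mul, norm_div]
    have h2 : ‖phase c ^ L - 1‖ ≤ 2 := by
      refine (norm_sub_le _ _).trans ?_
      rw [norm_pow, norm_phase]; norm_num
    have : ‖phase c ^ L - 1‖ / ‖phase c - 1‖ ≤ 2 / ‖phase c - 1‖ := by gcongr
    have : 0 ≤ ε * L := by positivity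
    linarith
  | succ d ih =>
    intro c hc ε hε
    -- The diagonal pairs and the off-diagonal pairs, each of the latter bounded with `1 / K`, both
    -- contribute `K * L`; this `K` makes `2 * K * L ^ 2 ≤ (K * ε * L) ^ 2`.
    obtain ⟨K, hK⟩ := exists_nat_gt (max 1 (2 / ε ^ 2))
    have hK1 : (1 : ℝ) < K := (le_max_left _ _).trans_lt hK
    have hK0 : (0 : ℝ) < K := by linarith
    have hKε : 2 * K ≤ (K * ε) ^ 2 := by
      have : 2 / ε ^ 2 < K := (le_max_right _ _).trans_lt hK
      rw [div_lt_iff₀ (by positivity)] at this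
      nlinarith
    have hkl : ∀ k l : ℕ, ∃ C : ℝ, 0 ≤ C ∧ (k ≠ l → ∀ f : ℕ → ℝ,
        (∀ n, (fwdDiff 1)^[d + 1] f n = ((k : ℤ) - l : ℤ) * c) → ∀ L : ℕ,
        ‖∑ n ∈ Finset.range L, phase (f n)‖ ≤ (1 / K) * L + C) := by
      intro k l
      by_cases hkl : k = l
      · exact ⟨0, le_rfl, fun h => absurd hkl h⟩
      · have hz : ((k : ℤ) - l) ≠ 0 := sub_ne_zero.2 (by exact_mod_cast hkl)
        obtain ⟨C, hC, h⟩ := ih _ (hc.intCast_mul hz) (1 / K) (by positivity)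
        exact ⟨C, hC, fun _ => h⟩
    choose C hC0 hC using hkl
    set B : ℝ := ∑ k ∈ Finset.range K, ∑ l ∈ Finset.range K, C k l with hB
    have hB0 : 0 ≤ B := Finset.sum_nonneg fun k _ => Finset.sum_nonneg fun l _ => hC0 k l
    set D : ℝ := B / (K * ε) with hD
    have hD0 : 0 ≤ D := by positivity
    refine ⟨2 * K + D / K, by positivity, fun f hf L => ?_⟩
    obtain ⟨T, hT0, hT1, hT2⟩ := van_der_corput (fun n => phase (f n))
      (fun n => (norm_phase _).le) L K
    have hpair : ∀ k l : ℕ, ‖∑ n ∈ Finset.range L,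
        phase (f (n + k)) * (starRingEnd ℂ) (phase (f (n + l)))‖ ≤
          ((if k = l then (L : ℝ) else 0) + (1 / K) * L) + C k l := by
      intro k l
      simp only [phase_mul_conj]
      by_cases h : k = l
      · subst h
        have : (0 : ℝ) ≤ 1 / K * L := by positivity
        simp only [sub_self, if_true]
        refine (norm_sum_le_of_le (n := fun _ => (1 : ℝ)) _
          fun n _ => (norm_phase _).le).trans ?_
        simp only [Finset.sum_const, Finset.card_range, nsmul_eq_mul, mul_one]
        linarith [hC0 k k]
      · rw [if_neg h, zero_add]
        refine hC k l h _ (fun n => ?_) L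
        -- The next difference is the constant `c`, so this one is affine with slope `c`, and shifts
        -- by `k` and `l` differ by `(k - l) * c`.
        have hlin : ∀ n, (fwdDiff 1)^[d + 1] f n = (fwdDiff 1)^[d + 1] f 0 + n * c := fun n =>
          eq_add_mul_of_fwdDiff_const (fun m => by
            have := hf m
            rwa [Function.iterate_succ_apply'] at this) n
        rw [fwdDiff_iter_sub (fun n => f (n + k)) (fun n => f (n + l)),
          fwdDiff_iter_comp_add, fwdDiff_iter_comp_add, hlin (n + k), hlin (n + l)]
        push_cast
        ring
    have htot : ∑ k ∈ Finset.range K, ∑ l ∈ Finset.range K, ‖∑ n ∈ Finset.range L,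
        phase (f (n + k)) * (starRingEnd ℂ) (phase (f (n + l)))‖ ≤ 2 * K * L + B := by
      refine (Finset.sum_le_sum fun k _ => Finset.sum_le_sum fun l _ => hpair k l).trans ?_
      simp only [Finset.sum_add_distrib, ← hB]
      gcongr
      have h1 : ∑ k ∈ Finset.range K, ∑ l ∈ Finset.range K, (if k = l then (L : ℝ) else 0) =
          K * L := by
        rw [Finset.sum_congr rfl (g := fun _ => (L : ℝ)) fun k hk => by
          rw [Finset.sum_ite_eq, if_pos hk]]
        simp
      rw [h1]
      simp only [Finset.sum_const, Finset.card_range, nsmul_eq_mul]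
      apply le_of_eq
      field_simp
      ring
    have hTle : T ≤ K * ε * L + D := by
      have hDB : K * ε * D = B := by rw [hD]; field_simp
      have hL : (0 : ℝ) ≤ L := L.cast_nonneg
      refine abs_le_of_sq_le_sq' ?_ (by positivity) |>.2
      calc T ^ 2 ≤ L * (2 * K * L + B) := hT2.trans (by gcongr)
        _ ≤ (K * ε * L + D) ^ 2 := by
          nlinarith [mul_le_mul_of_nonneg_right hKε (mul_nonneg hL hL), mul_nonneg hL hB0,
            sq_nonneg D, mul_nonneg hL hD0]
    have hfin : K * ‖∑ n ∈ Finset.range L, phase (f n)‖ ≤ K * (ε * L + (2 * K + D / K)) := by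
      refine hT1.trans ?_
      have : K * (ε * L + (2 * K + D / K)) = K * ε * L + 2 * K ^ 2 + D := by
        field_simp
        ring
      linarith
    exact le_of_mul_le_mul_left hfin hK0

/-- A sum twisted by a weight that is constant on the fibres of a monotone function. -/
lemma norm_sum_weighted_le {u w : ℕ → ℂ} {F : ℕ → ℕ} {ε C : ℝ} (hC : 0 ≤ C)
    (hu : ∀ a L : ℕ, ‖∑ n ∈ Finset.range L, u (a + n)‖ ≤ ε * L + C)
    (hw : ∀ n, ‖w n‖ ≤ 1) (hF : Monotone F) (hwF : ∀ m n, F m = F n → w m = w n) (N : ℕ) :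
    ‖∑ n ∈ Finset.range (N + 1), w n * u n‖ ≤ ε * (N + 1) + C * (F N + 1) := by
  induction N using Nat.strong_induction_on with
  | _ N ih =>
    have hex : ∃ a, F a = F N := ⟨N, rfl⟩
    classical
    -- `a` is the left end of the last fibre. Peeling that fibre off costs one `C`, and there are at
    -- most `F N + 1` fibres.
    obtain ⟨a, ha, hmin⟩ : ∃ a, F a = F N ∧ ∀ b < a, F b ≠ F N :=
      ⟨Nat.find hex, Nat.find_spec hex, fun b hb => Nat.find_min hex hb⟩
    have haN : a ≤ N := by
      by_contra h
      exact hmin N (not_le.1 h) rfl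
    obtain ⟨L, rfl⟩ := Nat.exists_eq_add_of_le haN
    have htail : ‖∑ n ∈ Finset.range (L + 1), w (a + n) * u (a + n)‖ ≤ ε * (L + 1) + C := by
      have hconst : ∀ n ∈ Finset.range (L + 1), w (a + n) * u (a + n) = w a * u (a + n) := by
        intro n hn
        have hn' : n ≤ L := Nat.lt_succ_iff.1 (Finset.mem_range.1 hn)
        rw [hwF (a + n) a]
        exact le_antisymm ((hF (by omega)).trans ha.ge) (hF (by omega))
      rw [Finset.sum_congr rfl hconst, ← Finset.mul_sum, norm_mul]
      calc _ ≤ 1 * ‖∑ n ∈ Finset.range (L + 1), u (a + n)‖ := by gcongr; exact hw a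
        _ ≤ _ := by simpa using hu a (L + 1)
    rw [add_assoc, Finset.sum_range_add]
    refine (norm_add_le _ _).trans ?_
    cases a with
    | zero =>
      have : 0 ≤ C * (F (0 + L) : ℝ) := by positivity
      simp only [Finset.range_zero, Finset.sum_empty, norm_zero, zero_add] at *
      linarith
    | succ b =>
      have h1 := ih b (by omega)
      have h2 : F b + 1 ≤ F (b + 1 + L) := by
        have := hF (show b ≤ b + 1 + L by omega)
        have := hmin b (by omega)
        omega
      have h3 : C * ((F b : ℝ) + 1) ≤ C * F (b + 1 + L) := by
        gcongr; exact_mod_cast h2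
      push_cast
      linarith

/-! ### Multiples of primes and the Turán–Kubilius inequality -/

/-- Since `g` vanishes from `N` on, `m` may run up to `N` instead of `N / p`, so that all primes
share one index range. -/
lemma sum_range_multiples {E : Type*} [AddCommMonoid E] {p N : ℕ} (hp : 0 < p) {g : ℕ → E}
    (hg : ∀ n, N ≤ n → g n = 0) :
    ∑ n ∈ Finset.range N, (if p ∣ n then g n else 0) = ∑ m ∈ Finset.range N, g (p * m) := by
  have h1 : ∑ m ∈ Finset.range N, g (p * m) =
      ∑ m ∈ Finset.range N with p * m < N, g (p * m) := by
    rw [Finset.sum_filter]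
    refine Finset.sum_congr rfl fun m _ => ?_
    split_ifs with h
    · rfl
    · exact hg _ (not_lt.1 h)
  rw [h1, ← Finset.sum_filter]
  refine Finset.sum_nbij' (· / p) (p * ·) ?_ ?_ ?_ ?_ ?_
  · intro n hn
    simp only [Finset.mem_filter, Finset.mem_range] at hn ⊢
    rw [Nat.mul_div_cancel' hn.2]
    exact ⟨(Nat.div_le_self _ _).trans_lt hn.1, hn.1⟩
  · intro m hm
    simp only [Finset.mem_filter, Finset.mem_range] at hm ⊢
    exact ⟨hm.2, dvd_mul_right _ _⟩
  · intro n hn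
    exact Nat.mul_div_cancel' (Finset.mem_filter.1 hn).2
  · intro m _
    exact Nat.mul_div_cancel_left m hp
  · intro n hn
    rw [Nat.mul_div_cancel' (Finset.mem_filter.1 hn).2]

/-- Zero is a multiple, so the count is `N / p` rounded up; the lower bound therefore carries no
error term. -/
lemma card_multiples_bounds {p : ℕ} (hp : 0 < p) (N : ℕ) :
    (N : ℝ) / p ≤ ∑ n ∈ Finset.range N, (if p ∣ n then (1 : ℝ) else 0) ∧
      ∑ n ∈ Finset.range N, (if p ∣ n then (1 : ℝ) else 0) ≤ N / p + 1 := by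
  have hp' : (0 : ℝ) < p := by exact_mod_cast hp
  rw [← Finset.sum_filter, Finset.sum_const, nsmul_eq_mul, mul_one]
  cases N with
  | zero => simp
  | succ N =>
    have hset : {n ∈ Finset.range (N + 1) | p ∣ n} =
        insert 0 {n ∈ Finset.range N.succ | n ≠ 0 ∧ p ∣ n} := by
      ext n
      rcases Nat.eq_zero_or_pos n with rfl | h
      · simp
      · simp [h.ne']
    rw [hset, Finset.card_insert_of_notMem (by simp), Nat.card_multiples']
    constructor
    · rw [div_le_iff₀ hp']
      have := Nat.lt_mul_div_succ N hp
      have h2 : N + 1 ≤ (N / p + 1) * p := by rw [mul_comm]; omega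
      exact_mod_cast h2
    · have h1 : ((N / p : ℕ) : ℝ) ≤ (N : ℝ) / p := Nat.cast_div_le
      have h2 : (N : ℝ) / p ≤ ((N + 1 : ℕ) : ℝ) / p := by gcongr; simp
      push_cast at *
      linarith

lemma card_mul_lt_le {p : ℕ} (hp : 0 < p) (N : ℕ) :
    ∑ m ∈ Finset.range N, (if p * m < N then (1 : ℝ) else 0) ≤ N / p + 1 := by
  rw [← sum_range_multiples hp (g := fun n => if n < N then (1 : ℝ) else 0)
    fun n hn => if_neg (not_lt.2 hn)]
  refine le_trans (le_of_eq ?_) (card_multiples_bounds hp N).2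
  refine Finset.sum_congr rfl fun n hn => ?_
  rw [if_pos (Finset.mem_range.1 hn)]

/-- The Turán–Kubilius inequality for a finite set of primes. -/
lemma turan_kubilius (S : Finset ℕ) (hS : ∀ p ∈ S, p.Prime) (N : ℕ) :
    ∑ n ∈ Finset.range N,
        (∑ p ∈ S, (1 : ℝ) / p - ∑ p ∈ S, (if p ∣ n then (1 : ℝ) else 0)) ^ 2 ≤
      N * ∑ p ∈ S, (1 : ℝ) / p + (S.card : ℝ) ^ 2 := by
  set A : ℝ := ∑ p ∈ S, (1 : ℝ) / p with hA
  have hA0 : 0 ≤ A := by positivity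
  have hlin : N * A ≤ ∑ n ∈ Finset.range N, ∑ p ∈ S, (if p ∣ n then (1 : ℝ) else 0) := by
    rw [Finset.sum_comm, hA, Finset.mul_sum]
    refine Finset.sum_le_sum fun p hp => ?_
    rw [mul_one_div]
    exact (card_multiples_bounds (hS p hp).pos N).1
  -- Divisibility by distinct primes is independent up to an error 1; these errors add up to `S.card
  -- ^ 2`, and the main term `N * A ^ 2` cancels when the square is expanded.
  have hpair : ∀ p ∈ S, ∀ q ∈ S, ∑ n ∈ Finset.range N,
      (if p ∣ n then (1 : ℝ) else 0) * (if q ∣ n then (1 : ℝ) else 0) ≤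
        N * ((1 / p) * (1 / q)) + (if p = q then (N : ℝ) * (1 / p) else 0) + 1 := by
    intro p hp q hq
    by_cases hpq : p = q
    · subst hpq
      rw [if_pos rfl]
      have h := (card_multiples_bounds (hS p hp).pos N).2
      have h0 : (0 : ℝ) ≤ N * ((1 / p) * (1 / p)) := by positivity
      rw [mul_one_div (N : ℝ) (p : ℝ)]
      refine le_trans (le_of_eq ?_) (h.trans (by linarith))
      refine Finset.sum_congr rfl fun n _ => ?_
      split_ifs <;> simp
    · rw [if_neg hpq, add_zero]
      have h := (card_multiples_bounds (Nat.mul_pos (hS p hp).pos (hS q hq).pos) N).2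
      have hcop : Nat.Coprime p q := (Nat.coprime_primes (hS p hp) (hS q hq)).2 hpq
      refine le_trans (le_of_eq ?_) (h.trans (le_of_eq ?_))
      · refine Finset.sum_congr rfl fun n _ => ?_
        rw [ite_zero_mul_ite_zero, mul_one]
        refine if_congr ?_ rfl rfl
        exact ⟨fun h => hcop.mul_dvd_of_dvd_of_dvd h.1 h.2,
          fun h => ⟨(dvd_mul_right _ _).trans h, (dvd_mul_left _ _).trans h⟩⟩
      · push_cast
        rw [one_div_mul_one_div, mul_one_div]
  have hquad : ∑ n ∈ Finset.range N, (∑ p ∈ S, (if p ∣ n then (1 : ℝ) else 0)) ^ 2 ≤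
      N * A ^ 2 + N * A + (S.card : ℝ) ^ 2 := by
    calc _ = ∑ p ∈ S, ∑ q ∈ S, ∑ n ∈ Finset.range N,
          (if p ∣ n then (1 : ℝ) else 0) * (if q ∣ n then (1 : ℝ) else 0) := by
          simp only [sq, Finset.sum_mul_sum]
          rw [Finset.sum_comm]
          exact Finset.sum_congr rfl fun p _ => Finset.sum_comm
      _ ≤ ∑ p ∈ S, ∑ q ∈ S,
          (N * ((1 / p) * (1 / q)) + (if p = q then (N : ℝ) * (1 / p) else 0) + 1) :=
          Finset.sum_le_sum fun p hp => Finset.sum_le_sum fun q hq => hpair p hp q hq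
      _ = _ := by
          simp only [Finset.sum_add_distrib, ← Finset.mul_sum, Finset.sum_const, nsmul_eq_mul,
            mul_one]
          congr 1
          · congr 1
            · rw [sq, hA, Finset.sum_mul_sum]
              simp only [Finset.mul_sum]
            · rw [hA, Finset.mul_sum]
              refine Finset.sum_congr rfl fun p hp => ?_
              rw [Finset.sum_ite_eq, if_pos hp]
          · ring
  have hexp : ∑ n ∈ Finset.range N, (A - ∑ p ∈ S, (if p ∣ n then (1 : ℝ) else 0)) ^ 2 =
      N * A ^ 2 - 2 * A * ∑ n ∈ Finset.range N, ∑ p ∈ S, (if p ∣ n then (1 : ℝ) else 0) +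
        ∑ n ∈ Finset.range N, (∑ p ∈ S, (if p ∣ n then (1 : ℝ) else 0)) ^ 2 := by
    simp only [sub_sq, Finset.sum_add_distrib, Finset.sum_sub_distrib, Finset.sum_const,
      Finset.card_range, nsmul_eq_mul, ← Finset.mul_sum]
  rw [hexp]
  nlinarith [mul_le_mul_of_nonneg_left hlin hA0]

/-- Dominated by `∑ 1/n²` from `n = 2`. This keeps the total defect of complete multiplicativity
`O(N)` independently of `A`. -/
lemma sum_one_div_sq_primes_le (S : Finset ℕ) (hS : ∀ p ∈ S, p.Prime) :
    ∑ p ∈ S, (1 : ℝ) / (p * p : ℕ) ≤ 1 := by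
  have hsub : S ⊆ Finset.Ioo 1 (S.sup id + 1) := fun p hp =>
    Finset.mem_Ioo.2 ⟨(hS p hp).one_lt, Nat.lt_succ_of_le (Finset.le_sup (f := id) hp)⟩
  calc ∑ p ∈ S, (1 : ℝ) / (p * p : ℕ)
      ≤ ∑ p ∈ Finset.Ioo 1 (S.sup id + 1), (1 : ℝ) / (p * p : ℕ) :=
        Finset.sum_le_sum_of_subset_of_nonneg hsub fun _ _ _ => by positivity
    _ = ∑ p ∈ Finset.Ioo 1 (S.sup id + 1), ((p : ℝ) ^ 2)⁻¹ :=
        Finset.sum_congr rfl fun p _ => by push_cast; rw [sq, one_div]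
    _ ≤ 1 := (sum_Ioo_inv_sq_le _ _).trans (by norm_num)

/-! ### Kátai's criterion -/

/-- The defect of complete multiplicativity along multiples of the primes in `S`. -/
lemma norm_sum_mul_defect_le {ν : ArithmeticFunction ℂ} (hν : ν.IsMultiplicative)
    (hb : ∀ n : ℕ, ‖ν n‖ ≤ 1) {a : ℕ → ℂ} (ha : ∀ n, ‖a n‖ ≤ 1) {N p : ℕ}
    (haN : ∀ n, N ≤ n → a n = 0) (hp : p.Prime) :
    ‖∑ m ∈ Finset.range N, a (p * m) * (ν (p * m) - ν p * ν m)‖ ≤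
      2 * (N * (1 / (p * p : ℕ)) + 1) := by
  -- The defect vanishes when `p` and `m` are coprime, so only multiples of `p * p` below `N` count.
  have hterm : ∀ m ∈ Finset.range N, ‖a (p * m) * (ν (p * m) - ν p * ν m)‖ ≤
      if p ∣ m then (if p * m < N then (2 : ℝ) else 0) else 0 := by
    intro m _
    split_ifs with h1 h2
    · rw [norm_mul]
      have h3 : ‖ν (p * m) - ν p * ν m‖ ≤ 2 := by
        refine (norm_sub_le _ _).trans ?_
        rw [norm_mul]
        nlinarith [hb (p * m), hb p, hb m, norm_nonneg (ν p), norm_nonneg (ν m)]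
      nlinarith [ha (p * m), norm_nonneg (a (p * m)), norm_nonneg (ν (p * m) - ν p * ν m)]
    · rw [haN _ (not_lt.1 h2)]; simp
    · rw [hν.map_mul_of_coprime ((Nat.Prime.coprime_iff_not_dvd hp).2 h1)]; simp
  refine (norm_sum_le_of_le _ hterm).trans ?_
  rw [sum_range_multiples hp.pos (g := fun m => if p * m < N then (2 : ℝ) else 0)
    fun n hn => if_neg (not_lt.2 (hn.trans (Nat.le_mul_of_pos_left n hp.pos)))]
  have h := card_mul_lt_le (Nat.mul_pos hp.pos hp.pos) N
  rw [mul_one_div]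
  refine le_trans (le_of_eq ?_) (mul_le_mul_of_nonneg_left h zero_le_two)
  rw [Finset.mul_sum]
  refine Finset.sum_congr rfl fun m _ => ?_
  rw [mul_assoc, mul_ite, mul_one, mul_zero]

/-- Cauchy–Schwarz step of the Kátai criterion. -/
lemma sq_sum_norm_prime_sum_le {z a : ℕ → ℂ} (hz : ∀ n, ‖z n‖ ≤ 1) (ha : ∀ n, ‖a n‖ ≤ 1)
    {N : ℕ} (haN : ∀ n, N ≤ n → a n = 0) (S : Finset ℕ) (hS : ∀ p ∈ S, p.Prime)
    (hcorr : ∀ p ∈ S, ∀ q ∈ S, p ≠ q → ‖∑ m ∈ Finset.range N,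
      a (p * m) * (starRingEnd ℂ) (a (q * m))‖ ≤ N / (S.card : ℝ) ^ 2) :
    (∑ m ∈ Finset.range N, ‖∑ p ∈ S, a (p * m) * z p‖) ^ 2 ≤
      N * (N * ∑ p ∈ S, (1 : ℝ) / p + S.card + N) := by
  refine (sq_sum_norm_sum_le (Finset.range N) S fun p m => a (p * m) * z p).trans ?_
  rw [Finset.card_range]
  gcongr
  have hpair : ∀ p ∈ S, ∀ q ∈ S, ‖∑ m ∈ Finset.range N,
      a (p * m) * z p * (starRingEnd ℂ) (a (q * m) * z q)‖ ≤
        (if p = q then (N : ℝ) * (1 / p) + 1 else 0) + N / (S.card : ℝ) ^ 2 := by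
    intro p hp q hq
    have hfac : ∑ m ∈ Finset.range N, a (p * m) * z p * (starRingEnd ℂ) (a (q * m) * z q) =
        (z p * (starRingEnd ℂ) (z q)) *
          ∑ m ∈ Finset.range N, a (p * m) * (starRingEnd ℂ) (a (q * m)) := by
      rw [Finset.mul_sum]
      refine Finset.sum_congr rfl fun m _ => ?_
      rw [map_mul]; ring
    have hzz : ‖z p * (starRingEnd ℂ) (z q)‖ ≤ 1 := by
      rw [norm_mul, RCLike.norm_conj]
      exact mul_le_one₀ (hz p) (norm_nonneg _) (hz q)
    rw [hfac, norm_mul]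
    refine (mul_le_of_le_one_left (norm_nonneg _) hzz).trans ?_
    by_cases hpq : p = q
    · subst hpq
      rw [if_pos rfl, mul_one_div]
      have h0 : (0 : ℝ) ≤ N / (S.card : ℝ) ^ 2 := by positivity
      refine le_trans ?_ (le_add_of_nonneg_right h0)
      refine le_trans (norm_sum_le_of_le _ fun m _ => ?_) (card_mul_lt_le (hS p hp).pos N)
      split_ifs with h
      · rw [norm_mul, RCLike.norm_conj]
        exact mul_le_one₀ (ha _) (norm_nonneg _) (ha _)
      · rw [haN _ (not_lt.1 h)]; simp
    · rw [if_neg hpq, zero_add]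
      exact hcorr p hp q hq hpq
  refine (Finset.sum_le_sum fun p hp => Finset.sum_le_sum fun q hq => hpair p hp q hq).trans ?_
  simp only [Finset.sum_add_distrib, Finset.sum_const, nsmul_eq_mul]
  have hdiag : ∑ p ∈ S, ∑ q ∈ S, (if p = q then (N : ℝ) * (1 / p) + 1 else 0) =
      N * ∑ p ∈ S, (1 : ℝ) / p + S.card := by
    rw [Finset.sum_congr rfl (g := fun p : ℕ => (N : ℝ) * (1 / p) + 1) fun p hp => by
      rw [Finset.sum_ite_eq, if_pos hp]]
    rw [Finset.sum_add_distrib, ← Finset.mul_sum]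
    simp
  rw [hdiag]
  gcongr
  rcases Nat.eq_zero_or_pos S.card with h | h
  · simp [h]
  · have h' : (0 : ℝ) < S.card := by exact_mod_cast h
    apply le_of_eq
    field_simp

/-- The Kátai criterion in finitary form. -/
theorem katai_criterion {ν : ArithmeticFunction ℂ} (hν : ν.IsMultiplicative)
    (hb : ∀ n : ℕ, ‖ν n‖ ≤ 1) {a : ℕ → ℂ} (ha : ∀ n, ‖a n‖ ≤ 1) {N : ℕ}
    (haN : ∀ n, N ≤ n → a n = 0) (S : Finset ℕ) (hS : ∀ p ∈ S, p.Prime)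
    (hSN : S.card ^ 2 ≤ N) (hA : 1 ≤ ∑ p ∈ S, (1 : ℝ) / p)
    (hcorr : ∀ p ∈ S, ∀ q ∈ S, p ≠ q → ‖∑ m ∈ Finset.range N,
      a (p * m) * (starRingEnd ℂ) (a (q * m))‖ ≤ N / (S.card : ℝ) ^ 2) :
    Real.sqrt (∑ p ∈ S, (1 : ℝ) / p) * ‖∑ n ∈ Finset.range N, a n * ν n‖ ≤ 8 * N := by
  set A : ℝ := ∑ p ∈ S, (1 : ℝ) / p with hAdef
  set ω : ℕ → ℝ := fun n => ∑ p ∈ S, (if p ∣ n then (1 : ℝ) else 0) with hω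
  have hA0 : 0 < A := by linarith
  have hN0 : (0 : ℝ) ≤ N := N.cast_nonneg
  have hcard2 : (S.card : ℝ) ^ 2 ≤ N := by exact_mod_cast hSN
  have hcard : (S.card : ℝ) ≤ N := by exact_mod_cast (Nat.le_self_pow two_ne_zero _).trans hSN
  have hsq : Real.sqrt A ^ 2 = A := Real.sq_sqrt hA0.le
  have hsqrt1 : 1 ≤ Real.sqrt A := Real.one_le_sqrt.2 hA
  -- Write `A = (A - ω n) + ω n`, unfold `ω` over `n = p * m`, and replace `ν (p * m)` by `ν p * ν
  -- m`. The three parts are handled by Turán–Kubilius, by the correlations, and by the defect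
  -- bound.
  have hmain : (A : ℂ) * ∑ n ∈ Finset.range N, a n * ν n =
      ∑ n ∈ Finset.range N, ((A - ω n : ℝ) : ℂ) * (a n * ν n) +
        (∑ m ∈ Finset.range N, ν m * ∑ p ∈ S, a (p * m) * ν p +
          ∑ p ∈ S, ∑ m ∈ Finset.range N, a (p * m) * (ν (p * m) - ν p * ν m)) := by
    have h1 : ∑ n ∈ Finset.range N, (ω n : ℂ) * (a n * ν n) =
        ∑ p ∈ S, ∑ m ∈ Finset.range N, a (p * m) * ν (p * m) := by
      calc _ = ∑ n ∈ Finset.range N, ∑ p ∈ S, (if p ∣ n then a n * ν n else 0) := by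
            refine Finset.sum_congr rfl fun n _ => ?_
            simp only [hω]
            push_cast
            rw [Finset.sum_mul]
            refine Finset.sum_congr rfl fun p _ => ?_
            split_ifs <;> simp
        _ = _ := by
            rw [Finset.sum_comm]
            refine Finset.sum_congr rfl fun p hp => ?_
            exact sum_range_multiples (hS p hp).pos (g := fun n => a n * ν n)
              fun n hn => by rw [haN n hn, zero_mul]
    have h2 : ∑ m ∈ Finset.range N, ν m * ∑ p ∈ S, a (p * m) * ν p =
        ∑ p ∈ S, ∑ m ∈ Finset.range N, a (p * m) * (ν p * ν m) := by
      simp only [Finset.mul_sum]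
      rw [Finset.sum_comm]
      exact Finset.sum_congr rfl fun p _ => Finset.sum_congr rfl fun m _ => by ring
    have h3 : ∑ m ∈ Finset.range N, ν m * ∑ p ∈ S, a (p * m) * ν p +
        ∑ p ∈ S, ∑ m ∈ Finset.range N, a (p * m) * (ν (p * m) - ν p * ν m) =
          ∑ n ∈ Finset.range N, (ω n : ℂ) * (a n * ν n) := by
      rw [h1, h2, ← Finset.sum_add_distrib]
      refine Finset.sum_congr rfl fun p _ => ?_
      rw [← Finset.sum_add_distrib]
      exact Finset.sum_congr rfl fun m _ => by ring
    rw [h3, ← Finset.sum_add_distrib, Finset.mul_sum]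
    refine Finset.sum_congr rfl fun n _ => ?_
    push_cast
    ring
  have haν : ∀ n, ‖a n * ν n‖ ≤ 1 := fun n => by
    rw [norm_mul]; exact mul_le_one₀ (ha n) (norm_nonneg _) (hb n)
  have hfirst : ‖∑ n ∈ Finset.range N, ((A - ω n : ℝ) : ℂ) * (a n * ν n)‖ ≤
      2 * Real.sqrt A * N := by
    have h1 : ‖∑ n ∈ Finset.range N, ((A - ω n : ℝ) : ℂ) * (a n * ν n)‖ ≤
        ∑ n ∈ Finset.range N, |A - ω n| := norm_sum_le_of_le _ fun n _ => by
      rw [norm_mul, Complex.norm_real, Real.norm_eq_abs]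
      exact mul_le_of_le_one_right (abs_nonneg _) (haν n)
    refine h1.trans (abs_le_of_sq_le_sq' ?_ (by positivity)).2
    refine sq_sum_le_card_mul_sum_sq.trans ?_
    simp only [sq_abs, Finset.card_range]
    calc (N : ℝ) * ∑ n ∈ Finset.range N, (A - ω n) ^ 2
        ≤ N * (N * A + (S.card : ℝ) ^ 2) := by gcongr; exact turan_kubilius S hS N
      _ ≤ N * (N * A + N * A) := by gcongr; nlinarith
      _ ≤ 4 * A * N ^ 2 := by nlinarith [mul_nonneg hA0.le (mul_nonneg hN0 hN0)]
      _ = (2 * Real.sqrt A * N) ^ 2 := by rw [mul_pow, mul_pow, hsq]; ring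
  have hsecond : ‖∑ m ∈ Finset.range N, ν m * ∑ p ∈ S, a (p * m) * ν p‖ ≤
      2 * Real.sqrt A * N := by
    have h1 : ‖∑ m ∈ Finset.range N, ν m * ∑ p ∈ S, a (p * m) * ν p‖ ≤
        ∑ m ∈ Finset.range N, ‖∑ p ∈ S, a (p * m) * ν p‖ := norm_sum_le_of_le _ fun m _ => by
      rw [norm_mul]
      exact mul_le_of_le_one_left (norm_nonneg _) (hb m)
    refine h1.trans (abs_le_of_sq_le_sq' ?_ (by positivity)).2
    calc _ ≤ N * (N * A + S.card + N) := sq_sum_norm_prime_sum_le hb ha haN S hS hcorr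
      _ ≤ N * (N * A + N * A + N * A) := by gcongr <;> nlinarith
      _ ≤ 4 * A * N ^ 2 := by nlinarith [mul_nonneg hA0.le (mul_nonneg hN0 hN0)]
      _ = (2 * Real.sqrt A * N) ^ 2 := by rw [mul_pow, mul_pow, hsq]; ring
  have hthird : ‖∑ p ∈ S, ∑ m ∈ Finset.range N, a (p * m) * (ν (p * m) - ν p * ν m)‖ ≤
      4 * N := by
    refine (norm_sum_le_of_le _ fun p hp =>
      norm_sum_mul_defect_le hν hb ha haN (hS p hp)).trans ?_
    rw [← Finset.mul_sum, Finset.sum_add_distrib, ← Finset.mul_sum]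
    simp only [Finset.sum_const, nsmul_eq_mul, mul_one]
    nlinarith [mul_le_mul_of_nonneg_left (sum_one_div_sq_primes_le S hS) hN0]
  -- The bounds `2√A N`, `2√A N` and `4N` add up to at most `8√A N`, because `√A ≥ 1`.
  have htotal : A * ‖∑ n ∈ Finset.range N, a n * ν n‖ ≤ Real.sqrt A * (8 * N) := by
    have h1 : A * ‖∑ n ∈ Finset.range N, a n * ν n‖ =
        ‖(A : ℂ) * ∑ n ∈ Finset.range N, a n * ν n‖ := by
      rw [norm_mul, Complex.norm_real, Real.norm_of_nonneg hA0.le]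
    rw [h1, hmain]
    refine (norm_add_le _ _).trans ?_
    have h2 := norm_add_le (∑ m ∈ Finset.range N, ν m * ∑ p ∈ S, a (p * m) * ν p)
      (∑ p ∈ S, ∑ m ∈ Finset.range N, a (p * m) * (ν (p * m) - ν p * ν m))
    nlinarith
  refine le_of_mul_le_mul_left ?_ (by linarith : 0 < Real.sqrt A)
  rw [← mul_assoc, ← sq, hsq]
  exact htotal

/-! ### Correlations of dilated polynomial phases -/

lemma fwdDiff_iter_eval_mul (P : Polynomial ℝ) {p : ℕ} (hp : p ≠ 0) (n : ℕ) :
    (fwdDiff 1)^[P.natDegree] (fun m : ℕ => P.eval ((p : ℝ) * m)) n =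
      P.leadingCoeff * p ^ P.natDegree * P.natDegree.factorial := by
  have hp' : (p : ℝ) ≠ 0 := by exact_mod_cast hp
  set Q := P.comp (Polynomial.C (p : ℝ) * Polynomial.X) with hQ
  have hdeg : Q.natDegree = P.natDegree := by
    rw [hQ, Polynomial.natDegree_comp, Polynomial.natDegree_C_mul_X _ hp', mul_one]
  have hlead : Q.leadingCoeff = P.leadingCoeff * p ^ P.natDegree := by
    rw [hQ, Polynomial.leadingCoeff_comp (by rw [Polynomial.natDegree_C_mul_X _ hp']; simp),
      Polynomial.leadingCoeff_mul, Polynomial.leadingCoeff_C, Polynomial.leadingCoeff_X, mul_one]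
  have h := congrFun Q.fwdDiff_iter_degree_eq_factorial (n : ℝ)
  rw [hdeg, hlead, fwdDiff_iter_eq_sum_shift] at h
  rw [fwdDiff_iter_eq_sum_shift]
  simpa [hQ] using h

/-- Correlations along dilates of a polynomial phase with a locally constant weight. -/
lemma exists_correlation_bound (P : Polynomial ℝ) (hP : P.natDegree ≠ 0)
    (hirr : Irrational P.leadingCoeff) {p q : ℕ} (hp : p ≠ 0) (hq : q ≠ 0) (hpq : p ≠ q)
    {η : ℝ} (hη : 0 < η) :
    ∃ C : ℝ, 0 ≤ C ∧ ∀ (b : ℕ → ℂ), (∀ j, ‖b j‖ ≤ 1) → ∀ (r H N : ℕ), 0 < N →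
      ‖∑ m ∈ Finset.range N, (b ((p * m - r) / H) * phase (P.eval ((p * m : ℕ) : ℝ))) *
        (starRingEnd ℂ) (b ((q * m - r) / H) * phase (P.eval ((q * m : ℕ) : ℝ)))‖ ≤
          η * N + C * ((p + q : ℝ) * N / H + 1) := by
  obtain ⟨d, hd⟩ := Nat.exists_eq_succ_of_ne_zero hP
  set f : ℕ → ℝ := fun m => P.eval ((p : ℝ) * m) - P.eval ((q : ℝ) * m) with hf
  set z : ℤ := ((p : ℤ) ^ P.natDegree - (q : ℤ) ^ P.natDegree) * P.natDegree.factorial with hz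
  have hz0 : z ≠ 0 := by
    refine mul_ne_zero (sub_ne_zero.2 ?_) (by exact_mod_cast P.natDegree.factorial_ne_zero)
    exact_mod_cast fun h => hpq (Nat.pow_left_injective hP h)
  have hfd : ∀ n, (fwdDiff 1)^[d + 1] f n = z * P.leadingCoeff := by
    intro n
    rw [← Nat.succ_eq_add_one, ← hd, hf, fwdDiff_iter_sub, fwdDiff_iter_eval_mul P hp,
      fwdDiff_iter_eval_mul P hq, hz]
    push_cast
    ring
  obtain ⟨C, hC0, hC⟩ := weyl_sum_le d _ (hirr.intCast_mul hz0) η hη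
  refine ⟨C, hC0, fun b hb r H N hN => ?_⟩
  obtain ⟨N, rfl⟩ := Nat.exists_eq_succ_of_ne_zero hN.ne'
  -- Both block indices are monotone, so their sum is constant only where each of them is; its
  -- fibres are the pieces of constant weight.
  set F : ℕ → ℕ := fun m => (p * m - r) / H + (q * m - r) / H with hF
  have hmono : ∀ k : ℕ, Monotone fun m => (k * m - r) / H := fun k m n hmn =>
    Nat.div_le_div_right (Nat.sub_le_sub_right (Nat.mul_le_mul_left k hmn) r)
  have hFmono : Monotone F := fun m n hmn => add_le_add (hmono p hmn) (hmono q hmn)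
  have hwF : ∀ m n, F m = F n →
      b ((p * m - r) / H) * (starRingEnd ℂ) (b ((q * m - r) / H)) =
        b ((p * n - r) / H) * (starRingEnd ℂ) (b ((q * n - r) / H)) := by
    intro m n h
    simp only [hF] at h
    have : (p * m - r) / H = (p * n - r) / H ∧ (q * m - r) / H = (q * n - r) / H := by
      rcases le_total m n with hmn | hmn
      · have h1 := hmono p hmn
        have h2 := hmono q hmn
        simp only at h1 h2
        omega
      · have h1 := hmono p hmn
        have h2 := hmono q hmn
        simp only at h1 h2
        omega
    rw [this.1, this.2]
  have hu : ∀ a L : ℕ, ‖∑ n ∈ Finset.range L, phase (f (a + n))‖ ≤ η * L + C := by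
    intro a L
    refine hC (fun n => f (a + n)) (fun n => ?_) L
    simp only [add_comm a]
    rw [fwdDiff_iter_comp_add, hfd]
  have hbound := norm_sum_weighted_le (u := fun n => phase (f n)) hC0 hu (fun m => by
    rw [norm_mul, RCLike.norm_conj]
    exact mul_le_one₀ (hb _) (norm_nonneg _) (hb _)) hFmono hwF N
  have hsum : ∑ m ∈ Finset.range (N + 1),
      (b ((p * m - r) / H) * phase (P.eval ((p * m : ℕ) : ℝ))) *
        (starRingEnd ℂ) (b ((q * m - r) / H) * phase (P.eval ((q * m : ℕ) : ℝ))) =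
      ∑ m ∈ Finset.range (N + 1),
        b ((p * m - r) / H) * (starRingEnd ℂ) (b ((q * m - r) / H)) * phase (f m) := by
    refine Finset.sum_congr rfl fun m _ => ?_
    rw [hf, ← phase_mul_conj, map_mul]
    push_cast
    ring
  rw [Nat.succ_eq_add_one, hsum]
  refine hbound.trans ?_
  have hFN : (F N : ℝ) ≤ (p + q : ℝ) * (N + 1) / H := by
    have hdiv : ∀ k : ℕ, (((k * N - r) / H : ℕ) : ℝ) ≤ (k : ℝ) * (N + 1) / H := fun k => by
      refine Nat.cast_div_le.trans ?_
      gcongr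
      have : k * N - r ≤ k * (N + 1) := (Nat.sub_le _ _).trans (by gcongr; omega)
      exact_mod_cast this
    simp only [hF]
    push_cast
    rw [add_mul, add_div]
    exact add_le_add (hdiv p) (hdiv q)
  push_cast
  gcongr

/-! ### From short windows to one long sum -/

lemma sum_range_mul_eq {E : Type*} [AddCommMonoid E] (f : ℕ → E) (J H : ℕ) :
    ∑ n ∈ Finset.range (J * H), f n =
      ∑ j ∈ Finset.range J, ∑ k ∈ Finset.range H, f (j * H + k) := by
  induction J with
  | zero => simp
  | succ J ih => rw [Finset.sum_range_succ, ← ih, Nat.succ_mul, Finset.sum_range_add]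

/-- The moduli of block sums are absorbed into a bounded weight constant on blocks. -/
lemma exists_block_weight (g : ℕ → ℂ) {M H r : ℕ} (hH : 0 < H) (hHM : H ≤ M) (hr : r < H) :
    ∃ b : ℕ → ℂ, (∀ j, ‖b j‖ ≤ 1) ∧ (∀ j, 2 * M / H + 1 ≤ j → b j = 0) ∧
      ((∑ j ∈ Finset.range (2 * M / H + 1), (if j * H + r ∈ Finset.Ico M (2 * M) then
        ‖∑ n ∈ Finset.Ico (j * H + r) (j * H + r + H), g n‖ else 0) : ℝ) : ℂ) =
        ∑ n ∈ Finset.range (r + (2 * M / H + 1) * H), b ((n - r) / H) * g n := by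
  set B : ℕ → ℂ := fun j => ∑ n ∈ Finset.Ico (j * H + r) (j * H + r + H), g n with hB
  -- When `B j = 0`, division by zero gives weight 0, which is harmless.
  refine ⟨fun j => if j * H + r ∈ Finset.Ico M (2 * M) then
    (starRingEnd ℂ) (B j) / ‖B j‖ else 0, fun j => ?_, fun j hj => ?_, ?_⟩
  · dsimp only
    split_ifs
    · rw [norm_div, RCLike.norm_conj, Complex.norm_real, norm_norm]
      exact div_self_le_one _
    · simp
  · refine if_neg fun h => ?_
    have h1 := (Finset.mem_Ico.1 h).2
    have h2 : 2 * M < H * (2 * M / H + 1) := Nat.lt_mul_div_succ _ hH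
    have h3 : H * (2 * M / H + 1) ≤ j * H := by rw [mul_comm]; gcongr
    omega
  -- For `n < r` truncated subtraction assigns `n` to block 0; that block starts at `r < H ≤ M`,
  -- outside the range, so its weight is 0.
  · have hzero : ∑ n ∈ Finset.range r, (if (n - r) / H * H + r ∈ Finset.Ico M (2 * M) then
        (starRingEnd ℂ) (B ((n - r) / H)) / ‖B ((n - r) / H)‖ else 0) * g n = 0 := by
      refine Finset.sum_eq_zero fun n hn => ?_
      have h0 : n - r = 0 := Nat.sub_eq_zero_of_le (Finset.mem_range.1 hn).le
      rw [h0, Nat.zero_div, if_neg, zero_mul]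
      rw [Finset.mem_Ico]
      omega
    rw [Finset.sum_range_add _ r, hzero, zero_add, sum_range_mul_eq]
    push_cast
    refine Finset.sum_congr rfl fun j _ => ?_
    have hblock : ∀ k ∈ Finset.range H, (r + (j * H + k) - r) / H = j := fun k hk => by
      rw [Nat.add_sub_cancel_left, mul_comm, Nat.mul_add_div hH,
        Nat.div_eq_of_lt (Finset.mem_range.1 hk), add_zero]
    rw [Finset.sum_congr (s₁ := Finset.range H) rfl fun k hk => by rw [hblock k hk],
      ← Finset.mul_sum]
    have hBj : ∑ k ∈ Finset.range H, g (r + (j * H + k)) = B j := by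
      simp only [hB]
      rw [Finset.sum_Ico_eq_sum_range, Nat.add_sub_cancel_left]
      exact Finset.sum_congr rfl fun k _ => by congr 1; ring
    change ((if j * H + r ∈ Finset.Ico M (2 * M) then ‖B j‖ else 0 : ℝ) : ℂ) = _
    rw [hBj]
    split_ifs
    · rw [div_mul_eq_mul_div, Complex.conj_mul', sq, mul_self_div_self]
    · simp

lemma exists_primes_sum_one_div_gt (R : ℝ) :
    ∃ S : Finset ℕ, (∀ p ∈ S, p.Prime) ∧ R < ∑ p ∈ S, (1 : ℝ) / p := by
  have h := (not_summable_iff_tendsto_nat_atTop_of_nonneg fun n =>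
    Set.indicator_nonneg (fun _ _ => by positivity) n).1 not_summable_one_div_on_primes
  obtain ⟨n, hn⟩ := (h.eventually_gt_atTop R).exists
  refine ⟨(Finset.range n).filter Nat.Prime, fun p hp => (Finset.mem_filter.1 hp).2, ?_⟩
  rw [Finset.sum_filter]
  simpa [Set.indicator_apply] using hn

/-- Bound for one residue class of starting points modulo the window length. -/
lemma exists_threshold_block_sum {ν : ArithmeticFunction ℂ} (hν : ν.IsMultiplicative)
    (hb : ∀ n : ℕ, ‖ν n‖ ≤ 1) (P : Polynomial ℝ) (hP : P.natDegree ≠ 0)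
    (hirr : Irrational P.leadingCoeff) {ε : ℝ} (hε : 0 < ε) :
    ∃ N₀ : ℕ, ∀ M H r : ℕ, N₀ ≤ M → N₀ ≤ H → 0 < H → H ≤ M → r < H →
      ∑ j ∈ Finset.range (2 * M / H + 1), (if j * H + r ∈ Finset.Ico M (2 * M) then
        ‖∑ n ∈ Finset.Ico (j * H + r) (j * H + r + H), phase (P.eval (n : ℝ)) * ν n‖ else 0) ≤
          ε * M := by
  -- Kátai's bound `8 * N` is at most `32 * M`, so `√A ≥ 32 / ε` suffices.
  obtain ⟨S, hS, hSR⟩ := exists_primes_sum_one_div_gt (max 1 ((32 / ε) ^ 2))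
  set A : ℝ := ∑ p ∈ S, (1 : ℝ) / p with hAdef
  have hA1 : 1 ≤ A := (le_max_left _ _).trans hSR.le
  have hAε : 32 / ε ≤ Real.sqrt A :=
    Real.le_sqrt_of_sq_le ((le_max_right _ _).trans hSR.le)
  have hcard : 0 < S.card := by
    refine Finset.card_pos.2 (Finset.nonempty_iff_ne_empty.2 fun h => ?_)
    rw [hAdef, h, Finset.sum_empty] at hA1
    linarith
  have hcard' : (0 : ℝ) < S.card := by exact_mod_cast hcard
  set η : ℝ := 1 / (S.card : ℝ) ^ 2 with hη
  have hη0 : 0 < η := by positivity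
  have hex : ∀ p q : ℕ, ∃ C : ℝ, 0 ≤ C ∧ (p ∈ S → q ∈ S → p ≠ q →
      ∀ (b : ℕ → ℂ), (∀ j, ‖b j‖ ≤ 1) → ∀ (r H N : ℕ), 0 < N →
      ‖∑ m ∈ Finset.range N, (b ((p * m - r) / H) * phase (P.eval ((p * m : ℕ) : ℝ))) *
        (starRingEnd ℂ) (b ((q * m - r) / H) * phase (P.eval ((q * m : ℕ) : ℝ)))‖ ≤
          η / 2 * N + C * ((p + q : ℝ) * N / H + 1)) := by
    intro p q
    by_cases h : p ∈ S ∧ q ∈ S ∧ p ≠ q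
    · obtain ⟨C, hC0, hC⟩ := exists_correlation_bound P hP hirr (hS p h.1).ne_zero
        (hS q h.2.1).ne_zero h.2.2 (half_pos hη0)
      exact ⟨C, hC0, fun _ _ _ => hC⟩
    · exact ⟨0, le_rfl, fun h1 h2 h3 => absurd ⟨h1, h2, h3⟩ h⟩
  choose C hC0 hC using hex
  set D : ℝ := ∑ p ∈ S, ∑ q ∈ S, C p q * (p + q + 1) with hD
  have hCD : ∀ p ∈ S, ∀ q ∈ S, C p q * (p + q + 1) ≤ D := fun p hp q hq => by
    have hnn : ∀ p q : ℕ, 0 ≤ C p q * (p + q + 1) := fun p q =>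
      mul_nonneg (hC0 p q) (by positivity)
    refine (Finset.single_le_sum (f := fun q : ℕ => C p q * ((p : ℝ) + q + 1))
      (fun q _ => hnn p q) hq).trans ?_
    exact Finset.single_le_sum (f := fun p : ℕ => ∑ q ∈ S, C p q * ((p : ℝ) + q + 1))
      (fun p _ => Finset.sum_nonneg fun q _ => hnn p q) hp
  -- With half of `η` spent on Weyl's main term, this makes `C (p + q) N / H` and `C` at most `η N /
  -- 4` each.
  obtain ⟨N₁, hN₁⟩ := exists_nat_ge (4 * D / η)
  refine ⟨max N₁ (S.card ^ 2), fun M H r hM hH hHpos hHM hr => ?_⟩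
  have hM1 := (le_max_left _ _).trans hM
  have hM2 := (le_max_right _ _).trans hM
  have hH1 := (le_max_left _ _).trans hH
  obtain ⟨b, hb1, hb0, hbsum⟩ :=
    exists_block_weight (fun n => phase (P.eval (n : ℝ)) * ν n) hHpos hHM hr
  set N : ℕ := r + (2 * M / H + 1) * H with hN
  have hMN : M ≤ N := by
    have : 2 * M < H * (2 * M / H + 1) := Nat.lt_mul_div_succ _ hHpos
    rw [mul_comm H] at this
    omega
  have hN4 : N ≤ 4 * M := by
    have := Nat.div_mul_le_self (2 * M) H
    rw [hN, add_mul, one_mul]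
    omega
  have hNpos : 0 < N := by omega
  have hNR : (0 : ℝ) < N := by exact_mod_cast hNpos
  have hHR : (0 : ℝ) < H := by exact_mod_cast hHpos
  have hkat := katai_criterion hν hb
    (a := fun n => b ((n - r) / H) * phase (P.eval (n : ℝ))) (N := N)
    (fun n => by rw [norm_mul, norm_phase, mul_one]; exact hb1 _)
    (fun n hn => by
      have hle : 2 * M / H + 1 ≤ (n - r) / H := (Nat.le_div_iff_mul_le hHpos).2 (by omega)
      rw [hb0 _ hle, zero_mul])
    S hS (hM2.trans hMN) hA1
    (fun p hp q hq hpq => by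
      refine (hC p q hp hq hpq b hb1 r H N hNpos).trans ?_
      have h1 : 4 * D ≤ η * H := by
        have : 4 * D / η ≤ H := hN₁.trans (by exact_mod_cast hH1)
        rwa [div_le_iff₀ hη0, mul_comm _ η] at this
      have h2 : 4 * D ≤ η * N := by
        have : 4 * D / η ≤ N := hN₁.trans (by exact_mod_cast hM1.trans hMN)
        rwa [div_le_iff₀ hη0, mul_comm _ η] at this
      have hc := hC0 p q
      have h3 : C p q * (p + q) ≤ D := by linarith [hCD p hp q hq]
      have h4 : C p q ≤ D := by
        have : 0 ≤ C p q * (p + q) := by positivity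
        linarith [hCD p hp q hq]
      have h5 : C p q * ((p + q : ℝ) * N / H) ≤ η / 4 * N := by
        rw [← mul_div_assoc, div_le_iff₀ hHR, ← mul_assoc]
        calc C p q * (p + q) * N ≤ (η * H / 4) * N := by gcongr; linarith
          _ = _ := by ring
      have h6 : (N : ℝ) / (S.card : ℝ) ^ 2 = η * N := by rw [hη]; ring
      rw [h6]
      linarith)
  set X : ℝ := ∑ j ∈ Finset.range (2 * M / H + 1), (if j * H + r ∈ Finset.Ico M (2 * M) then
        ‖∑ n ∈ Finset.Ico (j * H + r) (j * H + r + H), phase (P.eval (n : ℝ)) * ν n‖ else 0)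
    with hX
  have hX0 : 0 ≤ X := Finset.sum_nonneg fun j _ => by split_ifs <;> positivity
  have hXeq : X = ‖∑ n ∈ Finset.range N, b ((n - r) / H) * phase (P.eval (n : ℝ)) * ν n‖ := by
    simp only [mul_assoc]
    rw [← hbsum, Complex.norm_real, Real.norm_of_nonneg hX0]
  rw [← hXeq, ← hAdef] at hkat
  have h1 : 32 / ε * X ≤ 8 * (4 * M) := by
    refine (mul_le_mul_of_nonneg_right hAε hX0).trans (hkat.trans ?_)
    gcongr
    exact_mod_cast hN4
  rw [div_mul_eq_mul_div, div_le_iff₀ hε] at h1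
  linarith

theorem theorem5 (ν : ArithmeticFunction ℂ) (hν : ν.IsMultiplicative)
    (hν_bound : ∀ n : ℕ, ‖ν n‖ ≤ 1)
    (P : Polynomial ℝ) (hP : P.natDegree ≠ 0) (hP_irr : Irrational P.leadingCoeff) :
    Tendsto
      (fun p : ℕ × ℕ =>
        (1 / (p.1 : ℝ)) * ∑ m ∈ Finset.Ico p.1 (2 * p.1),
          (1 / (p.2 : ℝ)) * ‖∑ n ∈ Finset.Ico m (m + p.2),
            Complex.exp (2 * (Real.pi : ℂ) * Complex.I * ((P.eval (n : ℝ) : ℝ) : ℂ)) * ν n‖)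
      ((atTop ×ˢ atTop) ⊓ comap (fun p : ℕ × ℕ => (p.2 : ℝ) / (p.1 : ℝ)) (𝓝 0))
      (𝓝 0) := by
  rw [Metric.tendsto_nhds]
  intro ε hε
  obtain ⟨N₀, hN₀⟩ := exists_threshold_block_sum hν hν_bound P hP hP_irr (half_pos hε)
  -- Smallness of `H / M` enters as `H ≤ M`, which keeps the long sum of length at most `4 * M`.
  have hratio : ∀ᶠ p : ℕ × ℕ in comap (fun p : ℕ × ℕ => (p.2 : ℝ) / (p.1 : ℝ)) (𝓝 0),
      (p.2 : ℝ) / (p.1 : ℝ) < 1 :=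
    tendsto_comap.eventually (eventually_lt_nhds one_pos)
  have hlarge : ∀ᶠ p : ℕ × ℕ in (atTop ×ˢ atTop), max N₀ 1 ≤ p.1 ∧ max N₀ 1 ≤ p.2 :=
    (eventually_ge_atTop _).prod_mk (eventually_ge_atTop _)
  filter_upwards [hlarge.filter_mono inf_le_left, hratio.filter_mono inf_le_right]
  rintro ⟨M, H⟩ ⟨hM, hH⟩ hlt
  simp only at hM hH hlt ⊢
  have hM0 : 0 < M := (le_max_right _ _).trans hM
  have hH0 : 0 < H := (le_max_right _ _).trans hH
  have hMR : (0 : ℝ) < M := by exact_mod_cast hM0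
  have hHR : (0 : ℝ) < H := by exact_mod_cast hH0
  have hHM : H ≤ M := by
    rw [div_lt_one hMR] at hlt
    exact_mod_cast hlt.le
  set G : ℕ → ℝ := fun m =>
    ‖∑ n ∈ Finset.Ico m (m + H), phase (P.eval (n : ℝ)) * ν n‖ with hG
  have hsum : ∑ m ∈ Finset.Ico M (2 * M), G m ≤ H * (ε / 2 * M) := by
    have hsub : Finset.Ico M (2 * M) ⊆ Finset.range ((2 * M / H + 1) * H) := fun m hm => by
      have : 2 * M < H * (2 * M / H + 1) := Nat.lt_mul_div_succ _ hH0
      rw [mul_comm H] at this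
      exact Finset.mem_range.2 ((Finset.mem_Ico.1 hm).2.trans this)
    calc ∑ m ∈ Finset.Ico M (2 * M), G m
        = ∑ m ∈ Finset.range ((2 * M / H + 1) * H),
            (if m ∈ Finset.Ico M (2 * M) then G m else 0) := by
          rw [Finset.sum_ite_mem, Finset.inter_eq_right.2 hsub]
      -- Starting points are sorted by residue modulo `H`; each of the `H` classes contributes at
      -- most `ε / 2 * M`.
      _ = ∑ r ∈ Finset.range H, ∑ j ∈ Finset.range (2 * M / H + 1),
            (if j * H + r ∈ Finset.Ico M (2 * M) then G (j * H + r) else 0) := by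
          rw [sum_range_mul_eq, Finset.sum_comm]
      _ ≤ ∑ r ∈ Finset.range H, ε / 2 * M := Finset.sum_le_sum fun r hr =>
          hN₀ M H r ((le_max_left _ _).trans hM) ((le_max_left _ _).trans hH) hH0 hHM
            (Finset.mem_range.1 hr)
      _ = H * (ε / 2 * M) := by simp
  have hval : (1 / (M : ℝ)) * ∑ m ∈ Finset.Ico M (2 * M), (1 / (H : ℝ)) * G m ≤ ε / 2 := by
    rw [← Finset.mul_sum]
    calc (1 / (M : ℝ)) * (1 / (H : ℝ) * ∑ m ∈ Finset.Ico M (2 * M), G m)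
        ≤ (1 / (M : ℝ)) * (1 / (H : ℝ) * (H * (ε / 2 * M))) := by gcongr
      _ = ε / 2 := by field_simp
  have hnn : 0 ≤ (1 / (M : ℝ)) * ∑ m ∈ Finset.Ico M (2 * M), (1 / (H : ℝ)) * G m := by
    positivity
  rw [Real.dist_0_eq_abs]
  exact (abs_of_nonneg hnn).trans_lt (hval.trans_lt (half_lt_self hε))
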